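/- Fix $N\ge 1$ and a norm on $\mathbb{R}^N$, and let $\|\cdot\|$ be the generated matrix norm on real $N\times N$ matrices; vectors are compared coordinatewise and $\rho(A)$ denotes the spectral radius of $A$. A set $\mathcal{A}$ of entrywise positive real $N\times N$ matrices is called an $\mathcal{H}$-set (hourglass set) if, whenever $\tilde A u=v$ for some $\tilde A\in\mathcal{A}$ and some entrywise positive vectors $u,v$, the following hold: H1: either $Au\ge v$ for all $A\in\mathcal{A}$, or there is $\bar A\in\mathcal{A}$ with $\bar Au\le v$ and $\bar Au\ne v$; H2: either $Au\le v$ for all $A\in\mathcal{A}$, or there is $\bar A\in\mathcal{A}$ with $\bar Au\ge v$ and $\bar Au\ne v$. For a nonempty bounded set $\mathcal{B}$ of real $N\times N$ matrices and $n\ge1$ put $$\check\rho_n(\mathcal{B})=\inf_{A_i\in\mathcal{B}}\rho(A_n\cdots A_1)^{1/n},\qquad \hat\rho_n(\mathcal{B})=\sup_{A_i\in\mathcal{B}}\rho(A_n\cdots A_1)^{1/n},$$ $$\rho_{\min}(\mathcal{B})=\inf_{A\in\mathcal{B}}\rho(A),\qquad \rho_{\max}(\mathcal{B})=\sup_{A\in\mathcal{B}}\rho(A),$$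 and let $$\check\rho(\mathcal{B})=\inf_{n\ge1}\inf_{A_i\in\mathcal{B}}\|A_n\cdots A_1\|^{1/n},\qquad \hat\rho(\mathcal{B})=\sup_{n\ge1}\hat\rho_n(\mathcal{B})$$ be its lower and its generalized spectral radius. Theorem. Let $\mathcal{A}$ be a nonempty compact set of real $N\times N$ matrices lying in the closure, with respect to the Hausdorff metric, of the family of all nonempty compact $\mathcal{H}$-sets of positive $N\times N$ matrices, and let $\tilde{\mathcal{A}}$ be any set of matrices with $\mathcal{A}\subseteq\tilde{\mathcal{A}}\subseteq\mathrm{co}(\mathcal{A})$, where $\mathrm{co}$ denotes the convex hull. Then the infima and suprema $\rho_{\min}$ and $\rho_{\max}$ are attained on both $\mathcal{A}$ and $\tilde{\mathcal{A}}$, and: (i) $\check\rho_n(\tilde{\mathcal{A}})=\rho_{\min}(\mathcal{A})$ for all $n\ge1$, and therefore $\check\rho(\tilde{\mathcal{A}})=\rho_{\min}(\tilde{\mathcal{A}})=\rho_{\min}(\mathcal{A})$; moreover $\check\rho(\tilde{\mathcal{A}})=\lim_{n\to\infty}\inf_{A_i\in\tilde{\mathcal{A}}}\|A_n\cdots A_1\|^{1/n}$;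 (ii) $\hat\rho_n(\tilde{\mathcal{A}})=\rho_{\max}(\mathcal{A})$ for all $n\ge1$, and therefore $\hat\rho(\tilde{\mathcal{A}})=\rho_{\max}(\tilde{\mathcal{A}})=\rho_{\max}(\mathcal{A})$; moreover $\hat\rho(\tilde{\mathcal{A}})=\lim_{n\to\infty}\hat\rho_n(\tilde{\mathcal{A}})$. In particular the finiteness property holds with $n=1$ for both radii: $\check\rho(\tilde{\mathcal{A}})=\check\rho_1(\tilde{\mathcal{A}})$ and $\hat\rho(\tilde{\mathcal{A}})=\hat\rho_1(\tilde{\mathcal{A}})$. -/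

import Mathlib

open Filter Topology

noncomputable section

/-- Strict positivity of a vector: all coordinates are positive. -/
def PosVec {N : ℕ} (x : Fin N → ℝ) : Prop := ∀ i, 0 < x i

/-- Strict positivity of a matrix: all entries are positive. -/
def PosMat {N M : ℕ} (A : Matrix (Fin N) (Fin M) ℝ) : Prop := ∀ i j, 0 < A i j

/-- First half of the hourglass alternative, for the set `𝒜` and the vectors `u`, `v`
(the order on vectors is coordinatewise). -/
def HourglassH1 {N M : ℕ} (𝒜 : Set (Matrix (Fin N) (Fin M) ℝ))
    (u : Fin M → ℝ) (v : Fin N → ℝ) : Prop :=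
  (∀ A ∈ 𝒜, v ≤ A.mulVec u) ∨ ∃ A ∈ 𝒜, A.mulVec u ≤ v ∧ A.mulVec u ≠ v

/-- Second half of the hourglass alternative. -/
def HourglassH2 {N M : ℕ} (𝒜 : Set (Matrix (Fin N) (Fin M) ℝ))
    (u : Fin M → ℝ) (v : Fin N → ℝ) : Prop :=
  (∀ A ∈ 𝒜, A.mulVec u ≤ v) ∨ ∃ A ∈ 𝒜, v ≤ A.mulVec u ∧ A.mulVec u ≠ v

/-- Hourglass sets (`ℋ`-sets) of positive matrices. -/
def IsHourglass {N M : ℕ} (𝒜 : Set (Matrix (Fin N) (Fin M) ℝ)) : Prop :=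
  (∀ A ∈ 𝒜, PosMat A) ∧
    ∀ A ∈ 𝒜, ∀ (u : Fin M → ℝ) (v : Fin N → ℝ), PosVec u → PosVec v → A.mulVec u = v →
      HourglassH1 𝒜 u v ∧ HourglassH2 𝒜 u v

section HausdorffClosure

/- Matrices carry the entrywise maximum norm here. All norms on this finite-dimensional space are
equivalent, so the closure below does not depend on this choice. -/
attribute [local instance] Matrix.normedAddCommGroup

/-- The family of (nonempty) compact hourglass sets of positive `N × M` matrices. -/
def compactHourglass (N M : ℕ) : Set (Set (Matrix (Fin N) (Fin M) ℝ)) :=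
  {𝒜 | 𝒜.Nonempty ∧ IsCompact 𝒜 ∧ IsHourglass 𝒜}

/-- The closure of the family of compact hourglass sets in the space of all nonempty compact sets
of matrices, with respect to the Hausdorff metric. -/
def closureHourglass (N M : ℕ) : Set (Set (Matrix (Fin N) (Fin M) ℝ)) :=
  {𝒜 | 𝒜.Nonempty ∧ IsCompact 𝒜 ∧
    ∀ ε : ℝ, 0 < ε → ∃ ℬ ∈ compactHourglass N M, Metric.hausdorffDist 𝒜 ℬ < ε}

end HausdorffClosure

/-- The spectral radius of a real square matrix: the maximal modulus of its complex eigenvalues. -/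
def rho {N : ℕ} (A : Matrix (Fin N) (Fin N) ℝ) : ℝ :=
  (spectralRadius ℂ (A.map Complex.ofReal)).toReal

/-- The product `Aₙ ⋯ A₁` of a finite sequence of matrices. -/
def revProd {N n : ℕ} (A : Fin n → Matrix (Fin N) (Fin N) ℝ) : Matrix (Fin N) (Fin N) ℝ :=
  (List.ofFn A).reverse.prod

/-- The set of all numbers `f (Aₙ ⋯ A₁) ^ (1/n)`, with all `Aᵢ ∈ 𝒜`. -/
def rootValues {N : ℕ} (f : Matrix (Fin N) (Fin N) ℝ → ℝ) (n : ℕ)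
    (𝒜 : Set (Matrix (Fin N) (Fin N) ℝ)) : Set ℝ :=
  {r | ∃ A : Fin n → Matrix (Fin N) (Fin N) ℝ, (∀ i, A i ∈ 𝒜) ∧
    r = f (revProd A) ^ (1 / (n : ℝ))}

/-- `ρ̌ₙ(𝒜)`, the infimum of `ρ(Aₙ ⋯ A₁) ^ (1/n)`. -/
def rhoCheck {N : ℕ} (n : ℕ) (𝒜 : Set (Matrix (Fin N) (Fin N) ℝ)) : ℝ :=
  sInf (rootValues rho n 𝒜)

/-- `ρ̂ₙ(𝒜)`, the supremum of `ρ(Aₙ ⋯ A₁) ^ (1/n)`. -/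
def rhoHat {N : ℕ} (n : ℕ) (𝒜 : Set (Matrix (Fin N) (Fin N) ℝ)) : ℝ :=
  sSup (rootValues rho n 𝒜)

/-- `ρ_min(𝒜)`, the infimum of the spectral radii of the matrices in `𝒜`. -/
def rhoMin {N : ℕ} (𝒜 : Set (Matrix (Fin N) (Fin N) ℝ)) : ℝ := sInf (rho '' 𝒜)

/-- `ρ_max(𝒜)`, the supremum of the spectral radii of the matrices in `𝒜`. -/
def rhoMax {N : ℕ} (𝒜 : Set (Matrix (Fin N) (Fin N) ℝ)) : ℝ := sSup (rho '' 𝒜)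

/-- The matrix norm generated by a norm `p` on `ℝᴺ`. -/
def inducedNorm {N : ℕ} (p : Seminorm ℝ (Fin N → ℝ)) (A : Matrix (Fin N) (Fin N) ℝ) : ℝ :=
  sSup {r | ∃ x : Fin N → ℝ, p x ≤ 1 ∧ r = p (A.mulVec x)}

/-- The infimum of `‖Aₙ ⋯ A₁‖ ^ (1/n)`, for the matrix norm generated by `p`. -/
def normCheck {N : ℕ} (p : Seminorm ℝ (Fin N → ℝ)) (n : ℕ)
    (𝒜 : Set (Matrix (Fin N) (Fin N) ℝ)) : ℝ :=
  sInf (rootValues (inducedNorm p) n 𝒜)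

/-- The lower spectral radius `ρ̌(𝒜)`: the infimum over all `n ≥ 1` of the infima of
`‖Aₙ ⋯ A₁‖ ^ (1/n)`. -/
def lowerSpectralRadius {N : ℕ} (p : Seminorm ℝ (Fin N → ℝ))
    (𝒜 : Set (Matrix (Fin N) (Fin N) ℝ)) : ℝ :=
  ⨅ n : ℕ, normCheck p (n + 1) 𝒜

/-- The generalized spectral radius `ρ̂(𝒜)`: the supremum of `ρ̂ₙ(𝒜)` over all `n ≥ 1`. -/
def generalizedSpectralRadius {N : ℕ} (𝒜 : Set (Matrix (Fin N) (Fin N) ℝ)) : ℝ :=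
  ⨆ n : ℕ, rhoHat (n + 1) 𝒜

end

/-! Let `M` minimise the spectral radius over a compact hourglass set and let `u` be its Perron
vector, so that `M u = ρ(M) u`. The second alternative of H1 would supply a matrix `A` of the set
with `A u ≤ ρ(M) u` and `A u ≠ ρ(M) u`, and for positive `A` this forces `ρ(A) < ρ(M)`
(`PosMat.rho_lt`). Hence `A u ≥ ρ(M) u` for every `A` in the set. Since `u` is common to all `A`,
the inequality is preserved by convex combinations and by products of nonnegative matrices, so every
product of `n` matrices from the convex hull has spectral radius at least `ρ(M) ^ n`. The maximum is
symmetric, with H2 and `PosMat.lt_rho`.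

A Hausdorff limit may contain matrices with zero entries, so the argument is not repeated there.
Only the inequality between spectral radii passes to the limit, by compactness and by continuity of
`rho` on nonnegative matrices (`continuousOn_rho`).

Powers of the extremal matrix attain the bounds for `ρ` at every `n`. For norms, `ρ ≤ ‖·‖` gives the
lower bound and Gelfand's formula along powers of the minimiser gives the upper one. -/

/-! ### Gelfand's formula, monotonicity and continuity of the spectral radius, Collatz–Wielandt
bounds. -/

section RowSumNorm

attribute [local instance] Matrix.linftyOpNormedRing Matrix.linftyOpNormedAlgebra

variable {N : ℕ}

/-- Entrywise nonnegativity of a matrix. -/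
def NonnegMat (A : Matrix (Fin N) (Fin N) ℝ) : Prop := ∀ i j, 0 ≤ A i j

theorem rho_eq_zero_of_isEmpty (A : Matrix (Fin 0) (Fin 0) ℝ) : rho A = 0 := by
  rw [rho, spectrum.SpectralRadius.of_subsingleton]
  rfl

theorem rho_nonneg (A : Matrix (Fin N) (Fin N) ℝ) : 0 ≤ rho A := ENNReal.toReal_nonneg

theorem norm_map_ofReal (A : Matrix (Fin N) (Fin N) ℝ) :
    ‖A.map Complex.ofReal‖ = ‖A‖ := by
  simp [Matrix.linfty_opNorm_def]

theorem map_ofReal_pow (A : Matrix (Fin N) (Fin N) ℝ) (n : ℕ) :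
    (A ^ n).map Complex.ofReal = A.map Complex.ofReal ^ n :=
  map_pow (Complex.ofRealHom.mapMatrix (m := Fin N)) A n

theorem spectralRadius_ne_top (A : Matrix (Fin N) (Fin N) ℂ) : spectralRadius ℂ A ≠ ⊤ := by
  rcases Nat.eq_zero_or_pos N with rfl | hN
  · rw [spectrum.SpectralRadius.of_subsingleton]
    exact ENNReal.zero_ne_top
  · have : Nonempty (Fin N) := ⟨⟨0, hN⟩⟩
    exact ((spectrum.spectralRadius_le_nnnorm (𝕜 := ℂ) A).trans_lt ENNReal.coe_lt_top).ne

/-- Gelfand's formula for the complexified matrix; complexification commutes with powers and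
preserves the row-sum norm. -/
theorem tendsto_norm_pow_rpow (A : Matrix (Fin N) (Fin N) ℝ) :
    Tendsto (fun n : ℕ => ‖A ^ n‖ ^ (1 / n : ℝ)) atTop (𝓝 (rho A)) := by
  have h := (ENNReal.tendsto_toReal (spectralRadius_ne_top (A.map Complex.ofReal))).comp
    (spectrum.pow_norm_pow_one_div_tendsto_nhds_spectralRadius (A.map Complex.ofReal))
  refine h.congr fun n => ?_
  rw [Function.comp_apply, ← map_ofReal_pow, norm_map_ofReal,
    ENNReal.toReal_ofReal (by positivity)]

/-- A nonnegative function comparable with the norm obeys the Gelfand formula. -/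
theorem tendsto_pow_rpow_of_equiv {f : Matrix (Fin N) (Fin N) ℝ → ℝ} {a b : ℝ}
    (ha : 0 < a) (hb : 0 < b) (h₁ : ∀ A, a * ‖A‖ ≤ f A) (h₂ : ∀ A, f A ≤ b * ‖A‖)
    (A : Matrix (Fin N) (Fin N) ℝ) :
    Tendsto (fun n : ℕ => f (A ^ n) ^ (1 / n : ℝ)) atTop (𝓝 (rho A)) := by
  have key : ∀ c : ℝ, 0 < c →
      Tendsto (fun n : ℕ => (c * ‖A ^ n‖) ^ (1 / n : ℝ)) atTop (𝓝 (rho A)) := by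
    intro c hc
    have h0 : Tendsto (fun n : ℕ => (1 / n : ℝ)) atTop (𝓝 0) := tendsto_one_div_atTop_nhds_zero_nat
    have h1 : Tendsto (fun n : ℕ => c ^ (1 / n : ℝ)) atTop (𝓝 1) := by
      have := tendsto_const_nhds (x := c) |>.rpow h0 (Or.inl hc.ne')
      simpa using this
    have := h1.mul (tendsto_norm_pow_rpow A)
    rw [one_mul] at this
    refine this.congr fun n => ?_
    rw [Real.mul_rpow hc.le (norm_nonneg _)]
  refine tendsto_of_tendsto_of_tendsto_of_le_of_le (key a ha) (key b hb) (fun n => ?_) fun n => ?_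
  · exact Real.rpow_le_rpow (by positivity) (h₁ _) (by positivity)
  · exact Real.rpow_le_rpow ((by positivity : 0 ≤ a * ‖A ^ n‖).trans (h₁ _)) (h₂ _) (by positivity)

/-- If `f (A ^ n)` dominates `δ * c ^ n` and `f` obeys the Gelfand formula at `A`,
then `c ≤ rho A`. -/
theorem le_rho_of_forall_le {f : Matrix (Fin N) (Fin N) ℝ → ℝ} {A : Matrix (Fin N) (Fin N) ℝ}
    (hf : Tendsto (fun n : ℕ => f (A ^ n) ^ (1 / n : ℝ)) atTop (𝓝 (rho A)))
    {c δ : ℝ} (hδ : 0 < δ) (hc : 0 ≤ c) (h : ∀ n : ℕ, δ * c ^ n ≤ f (A ^ n)) : c ≤ rho A := by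
  have h0 : Tendsto (fun n : ℕ => (1 / n : ℝ)) atTop (𝓝 0) := tendsto_one_div_atTop_nhds_zero_nat
  have h1 : Tendsto (fun n : ℕ => δ ^ (1 / n : ℝ) * c) atTop (𝓝 c) := by
    have := (tendsto_const_nhds (x := δ) |>.rpow h0 (Or.inl hδ.ne')).mul_const c
    simpa using this
  refine le_of_tendsto_of_tendsto h1 hf ?_
  filter_upwards [eventually_ge_atTop 1] with n hn
  calc δ ^ (1 / n : ℝ) * c = (δ * c ^ n) ^ (1 / n : ℝ) := by
        rw [Real.mul_rpow hδ.le (by positivity), one_div,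
          Real.pow_rpow_inv_natCast hc (by omega)]
    _ ≤ _ := Real.rpow_le_rpow (by positivity) (h n) (by positivity)

/-- If `f (A ^ n)` is at most `K * c ^ n` and `f` obeys the Gelfand formula at `A`,
then `rho A ≤ c`. -/
theorem rho_le_of_forall_le {f : Matrix (Fin N) (Fin N) ℝ → ℝ} {A : Matrix (Fin N) (Fin N) ℝ}
    (hf : Tendsto (fun n : ℕ => f (A ^ n) ^ (1 / n : ℝ)) atTop (𝓝 (rho A)))
    (hf0 : ∀ B, 0 ≤ f B) {c K : ℝ} (hK : 0 < K) (hc : 0 ≤ c)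
    (h : ∀ n : ℕ, 1 ≤ n → f (A ^ n) ≤ K * c ^ n) : rho A ≤ c := by
  have h0 : Tendsto (fun n : ℕ => (1 / n : ℝ)) atTop (𝓝 0) := tendsto_one_div_atTop_nhds_zero_nat
  have h1 : Tendsto (fun n : ℕ => K ^ (1 / n : ℝ) * c) atTop (𝓝 c) := by
    have := (tendsto_const_nhds (x := K) |>.rpow h0 (Or.inl hK.ne')).mul_const c
    simpa using this
  refine le_of_tendsto_of_tendsto hf h1 ?_
  filter_upwards [eventually_ge_atTop 1] with n hn
  calc f (A ^ n) ^ (1 / n : ℝ) ≤ (K * c ^ n) ^ (1 / n : ℝ) :=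
        Real.rpow_le_rpow (hf0 _) (h n hn) (by positivity)
    _ = _ := by
        rw [Real.mul_rpow hK.le (by positivity), one_div,
          Real.pow_rpow_inv_natCast hc (by omega)]

theorem rho_le_norm (A : Matrix (Fin N) (Fin N) ℝ) : rho A ≤ ‖A‖ :=
  rho_le_of_forall_le (tendsto_norm_pow_rpow A) norm_nonneg one_pos (norm_nonneg A)
    fun n hn => by simpa using norm_pow_le' A hn

theorem rho_pow (A : Matrix (Fin N) (Fin N) ℝ) {n : ℕ} (hn : n ≠ 0) : rho (A ^ n) = rho A ^ n := by
  have h1 := tendsto_norm_pow_rpow (A ^ n)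
  have h2 : Tendsto (fun k : ℕ => n * k) atTop atTop :=
    tendsto_id.const_mul_atTop' (Nat.pos_of_ne_zero hn)
  have h3 := ((tendsto_norm_pow_rpow A).comp h2).pow n
  refine tendsto_nhds_unique h1 (h3.congr' ?_)
  filter_upwards with k
  have hn' : (n : ℝ) ≠ 0 := by exact_mod_cast hn
  simp only [Function.comp_apply]
  rw [← Real.rpow_natCast, ← Real.rpow_mul (norm_nonneg _), pow_mul]
  congr 1
  push_cast
  rw [one_div, mul_inv]
  field_simp

theorem rho_smul (A : Matrix (Fin N) (Fin N) ℝ) {c : ℝ} (hc : 0 ≤ c) :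
    rho (c • A) = c * rho A := by
  refine tendsto_nhds_unique (tendsto_norm_pow_rpow (c • A))
    (((tendsto_norm_pow_rpow A).const_mul c).congr' ?_)
  filter_upwards [eventually_ge_atTop 1] with n hn
  rw [smul_pow, norm_smul, Real.norm_of_nonneg (by positivity),
    Real.mul_rpow (by positivity) (norm_nonneg _), one_div,
    Real.pow_rpow_inv_natCast hc (by omega)]

theorem NonnegMat.mul {A B : Matrix (Fin N) (Fin N) ℝ} (hA : NonnegMat A) (hB : NonnegMat B) :
    NonnegMat (A * B) := fun i j => by
  rw [Matrix.mul_apply]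
  exact Finset.sum_nonneg fun k _ => mul_nonneg (hA i k) (hB k j)

theorem nonnegMat_one : NonnegMat (1 : Matrix (Fin N) (Fin N) ℝ) := fun i j => by
  rw [Matrix.one_apply]
  split_ifs <;> norm_num

theorem NonnegMat.pow {A : Matrix (Fin N) (Fin N) ℝ} (hA : NonnegMat A) (n : ℕ) :
    NonnegMat (A ^ n) := by
  induction n with
  | zero => simpa using nonnegMat_one
  | succ n ih => rw [pow_succ]; exact ih.mul hA

theorem pow_apply_le_pow_apply {A B : Matrix (Fin N) (Fin N) ℝ} (hA : NonnegMat A)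
    (hAB : ∀ i j, A i j ≤ B i j) (n : ℕ) : ∀ i j, (A ^ n) i j ≤ (B ^ n) i j := by
  induction n with
  | zero => simp
  | succ n ih =>
    intro i j
    rw [pow_succ, pow_succ, Matrix.mul_apply, Matrix.mul_apply]
    exact Finset.sum_le_sum fun k _ => mul_le_mul (ih i k) (hAB k j) (hA k j)
      ((hA.pow n i k).trans (ih i k))

theorem norm_le_norm_of_entry_le {A B : Matrix (Fin N) (Fin N) ℝ} (hA : NonnegMat A)
    (hAB : ∀ i j, A i j ≤ B i j) : ‖A‖ ≤ ‖B‖ := by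
  rw [← coe_nnnorm, ← coe_nnnorm, NNReal.coe_le_coe, Matrix.linfty_opNNNorm_def,
    Matrix.linfty_opNNNorm_def]
  refine Finset.sup_mono_fun fun i _ => Finset.sum_le_sum fun j _ => ?_
  rw [← NNReal.coe_le_coe, coe_nnnorm, coe_nnnorm, Real.norm_of_nonneg (hA i j),
    Real.norm_of_nonneg ((hA i j).trans (hAB i j))]
  exact hAB i j

theorem rho_le_rho {A B : Matrix (Fin N) (Fin N) ℝ} (hA : NonnegMat A)
    (hAB : ∀ i j, A i j ≤ B i j) : rho A ≤ rho B :=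
  le_of_tendsto_of_tendsto' (tendsto_norm_pow_rpow A) (tendsto_norm_pow_rpow B) fun n =>
    Real.rpow_le_rpow (norm_nonneg _)
      (norm_le_norm_of_entry_le (hA.pow n) (pow_apply_le_pow_apply hA hAB n)) (by positivity)

/-- Gelfand's formula gives an `n` with `‖A ^ n‖ < b ^ n`. This is an open condition on the matrix,
and `ρ(B) ^ n = ρ(B ^ n) ≤ ‖B ^ n‖` turns it into `ρ(B) < b` nearby. -/
theorem upperSemicontinuous_rho :
    UpperSemicontinuous (rho : Matrix (Fin N) (Fin N) ℝ → ℝ) := by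
  intro A b hb
  have hb0 : 0 < b := (rho_nonneg A).trans_lt hb
  obtain ⟨n, hn, hn1⟩ := (((tendsto_norm_pow_rpow A).eventually_lt_const hb).and
    (eventually_ge_atTop 1)).exists
  have hlt : ‖A ^ n‖ < b ^ n := by
    have h := pow_lt_pow_left₀ hn (by positivity) (by omega : n ≠ 0)
    rwa [one_div, Real.rpow_inv_natCast_pow (norm_nonneg _) (by omega)] at h
  have hcont : Continuous fun B : Matrix (Fin N) (Fin N) ℝ => ‖B ^ n‖ := (continuous_pow n).norm
  filter_upwards [hcont.continuousAt.eventually_lt_const hlt] with B hB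
  refine lt_of_pow_lt_pow_left₀ n hb0.le ?_
  rw [← rho_pow B (by omega)]
  exact (rho_le_norm _).trans_lt hB

/-- Lower semicontinuity comes from monotonicity: for `t < 1`, nonnegative matrices near `A`
dominate `t • A` entrywise, so their spectral radius is at least `t * ρ(A)`. -/
theorem continuousOn_rho :
    ContinuousOn rho {A : Matrix (Fin N) (Fin N) ℝ | NonnegMat A} := by
  intro A hA
  refine tendsto_order.2 ⟨fun a ha => ?_, fun b hb =>
    (upperSemicontinuous_rho A b hb).filter_mono nhdsWithin_le_nhds⟩
  obtain ⟨t, ht0, ht1, hta⟩ : ∃ t : ℝ, 0 ≤ t ∧ t < 1 ∧ a < t * rho A := by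
    have hc : Tendsto (fun t : ℝ => t * rho A) (𝓝[<] 1) (𝓝 (1 * rho A)) :=
      ((continuous_id.mul continuous_const).tendsto (1 : ℝ)).mono_left nhdsWithin_le_nhds
    rw [one_mul] at hc
    have h0 : ∀ᶠ t : ℝ in 𝓝[<] 1, 0 ≤ t :=
      (eventually_ge_nhds (zero_lt_one (α := ℝ))).filter_mono nhdsWithin_le_nhds
    obtain ⟨t, h1, h2, h3⟩ := ((hc.eventually_const_lt ha).and
      (h0.and self_mem_nhdsWithin)).exists
    exact ⟨t, h2, h3, h1⟩
  have hent : ∀ᶠ B in 𝓝[{A : Matrix (Fin N) (Fin N) ℝ | NonnegMat A}] A,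
      ∀ i j, t * A i j ≤ B i j := by
    refine eventually_all.2 fun i => eventually_all.2 fun j => ?_
    -- At a zero entry of `A` the bound is the nonnegativity of `B`; at a positive entry it is an
    -- open condition.
    rcases (hA i j).eq_or_lt with h | h
    · filter_upwards [self_mem_nhdsWithin] with B hB
      rw [← h, mul_zero]
      exact hB i j
    · have : t * A i j < A i j := by nlinarith
      have hc : ContinuousAt (fun B : Matrix (Fin N) (Fin N) ℝ => B i j) A :=
        (continuous_id.matrix_elem i j).continuousAt
      exact ((hc.eventually_const_lt this).mono fun _ h => h.le).filter_mono nhdsWithin_le_nhds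
  filter_upwards [hent] with B hB
  refine hta.trans_le ?_
  rw [← rho_smul A ht0]
  exact rho_le_rho (fun i j => mul_nonneg ht0 (hA i j)) hB

theorem mulVec_apply_eq_sum (A : Matrix (Fin N) (Fin N) ℝ) (x : Fin N → ℝ) (i : Fin N) :
    A.mulVec x i = ∑ j, A i j * x j := rfl

theorem NonnegMat.mulVec_mono {A : Matrix (Fin N) (Fin N) ℝ} (hA : NonnegMat A)
    {x y : Fin N → ℝ} (h : x ≤ y) : A.mulVec x ≤ A.mulVec y := fun i => by
  rw [mulVec_apply_eq_sum, mulVec_apply_eq_sum]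
  exact Finset.sum_le_sum fun j _ => mul_le_mul_of_nonneg_left (h j) (hA i j)

theorem NonnegMat.pow_smul_le_pow_mulVec {A : Matrix (Fin N) (Fin N) ℝ} (hA : NonnegMat A)
    {u : Fin N → ℝ} {c : ℝ} (hc : 0 ≤ c) (h : c • u ≤ A.mulVec u) (n : ℕ) :
    c ^ n • u ≤ (A ^ n).mulVec u := by
  induction n with
  | zero => simp
  | succ n ih =>
    calc c ^ (n + 1) • u = c ^ n • (c • u) := by rw [smul_smul, pow_succ]
      _ ≤ c ^ n • A.mulVec u := smul_le_smul_of_nonneg_left h (by positivity)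
      _ = A.mulVec (c ^ n • u) := by rw [Matrix.mulVec_smul]
      _ ≤ A.mulVec ((A ^ n).mulVec u) := hA.mulVec_mono ih
      _ = _ := by rw [Matrix.mulVec_mulVec, ← pow_succ']

theorem NonnegMat.pow_mulVec_le_pow_smul {A : Matrix (Fin N) (Fin N) ℝ} (hA : NonnegMat A)
    {u : Fin N → ℝ} {c : ℝ} (hc : 0 ≤ c) (h : A.mulVec u ≤ c • u) (n : ℕ) :
    (A ^ n).mulVec u ≤ c ^ n • u := by
  induction n with
  | zero => simp
  | succ n ih =>
    calc (A ^ (n + 1)).mulVec u = A.mulVec ((A ^ n).mulVec u) := by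
          rw [Matrix.mulVec_mulVec, ← pow_succ']
      _ ≤ A.mulVec (c ^ n • u) := hA.mulVec_mono ih
      _ = c ^ n • A.mulVec u := by rw [Matrix.mulVec_smul]
      _ ≤ c ^ n • (c • u) := smul_le_smul_of_nonneg_left h (by positivity)
      _ = _ := by rw [smul_smul, pow_succ]

/-- Iteration gives `c ^ n • u ≤ A ^ n u`, so one coordinate already makes `‖A ^ n‖` grow at least
like `c ^ n`. -/
theorem le_rho_of_smul_le_mulVec [NeZero N] {A : Matrix (Fin N) (Fin N) ℝ} (hA : NonnegMat A)
    {u : Fin N → ℝ} (hu : PosVec u) {c : ℝ} (h : c • u ≤ A.mulVec u) : c ≤ rho A := by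
  rcases lt_or_ge c 0 with hc | hc
  · exact hc.le.trans (rho_nonneg A)
  have hu0 : 0 < ‖u‖ := norm_pos_iff.2 fun h0 => by simpa [h0] using hu 0
  have hpos : 0 < u 0 / ‖u‖ := div_pos (hu 0) hu0
  refine le_rho_of_forall_le (tendsto_norm_pow_rpow A) hpos hc fun n => ?_
  have h1 : c ^ n * u 0 ≤ ‖A ^ n‖ * ‖u‖ :=
    calc c ^ n * u 0 ≤ (A ^ n).mulVec u 0 := hA.pow_smul_le_pow_mulVec hc h n 0
      _ ≤ ‖(A ^ n).mulVec u 0‖ := le_abs_self _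
      _ ≤ ‖(A ^ n).mulVec u‖ := norm_le_pi_norm _ 0
      _ ≤ _ := Matrix.linfty_opNorm_mulVec _ _
  rw [div_mul_eq_mul_div, div_le_iff₀ hu0, mul_comm]
  exact h1

/-- For a nonnegative matrix, the row sums are controlled by its action on a single vector bounded
below by `δ`. -/
theorem norm_le_div_of_mulVec_le [NeZero N] {A : Matrix (Fin N) (Fin N) ℝ} (hA : NonnegMat A)
    {u : Fin N → ℝ} {δ K : ℝ} (hδ : 0 < δ) (hu : ∀ i, δ ≤ u i)
    (h : ∀ i, A.mulVec u i ≤ K) : ‖A‖ ≤ K / δ := by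
  obtain ⟨i, -, hi⟩ := Finset.exists_mem_eq_sup (Finset.univ : Finset (Fin N))
    ⟨0, Finset.mem_univ _⟩ fun i => ∑ j, ‖A i j‖₊
  rw [Matrix.linfty_opNorm_def, hi, le_div_iff₀ hδ]
  refine le_trans ?_ (h i)
  push_cast
  rw [Finset.sum_mul, mulVec_apply_eq_sum]
  refine Finset.sum_le_sum fun j _ => ?_
  rw [Real.norm_of_nonneg (hA i j)]
  exact mul_le_mul_of_nonneg_left (hu j) (hA i j)

theorem rho_le_of_mulVec_le_smul [NeZero N] {A : Matrix (Fin N) (Fin N) ℝ} (hA : NonnegMat A)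
    {u : Fin N → ℝ} (hu : PosVec u) {c : ℝ} (h : A.mulVec u ≤ c • u) : rho A ≤ c := by
  -- The sign of `c` is forced by one coordinate of `0 ≤ A u ≤ c u`.
  have hc : 0 ≤ c := by
    have h1 : 0 ≤ A.mulVec u 0 := by
      rw [mulVec_apply_eq_sum]
      exact Finset.sum_nonneg fun j _ => mul_nonneg (hA 0 j) (hu j).le
    have h2 : A.mulVec u 0 ≤ c * u 0 := h 0
    exact nonneg_of_mul_nonneg_left (h1.trans h2) (hu 0)
  obtain ⟨i, hi⟩ := Finite.exists_min u
  have hu0 : 0 < ‖u‖ := norm_pos_iff.2 fun h0 => by simpa [h0] using hu 0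
  refine rho_le_of_forall_le (tendsto_norm_pow_rpow A) norm_nonneg (div_pos hu0 (hu i)) hc
    fun n _ => ?_
  rw [div_mul_eq_mul_div]
  refine norm_le_div_of_mulVec_le (hA.pow n) (hu i) hi fun k => ?_
  calc (A ^ n).mulVec u k ≤ c ^ n * u k := hA.pow_mulVec_le_pow_smul hc h n k
    _ ≤ c ^ n * ‖u‖ := by gcongr; exact (le_abs_self _).trans (norm_le_pi_norm u k)
    _ = _ := mul_comm _ _

end RowSumNorm

/-! ### Perron vectors and products of matrices from a compact hourglass set. -/

section Perron

variable {N : ℕ}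

theorem PosMat.nonnegMat {A : Matrix (Fin N) (Fin N) ℝ} (hA : PosMat A) : NonnegMat A :=
  fun i j => (hA i j).le

theorem PosMat.posVec_mulVec {A : Matrix (Fin N) (Fin N) ℝ} (hA : PosMat A) {x : Fin N → ℝ}
    (hx : 0 ≤ x) (hx0 : x ≠ 0) : PosVec (A.mulVec x) := fun i => by
  obtain ⟨k, hk⟩ := Function.ne_iff.1 hx0
  rw [mulVec_apply_eq_sum]
  exact Finset.sum_pos' (fun j _ => mul_nonneg (hA i j).le (hx j))
    ⟨k, Finset.mem_univ _, mul_pos (hA i k) ((hx k).lt_of_ne' hk)⟩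

/-- A positive matrix sends the nonzero nonnegative vector `A u - c u` to a strictly positive one,
so applying `A` once makes the inequality strict in every coordinate. -/
theorem PosMat.smul_mulVec_lt {A : Matrix (Fin N) (Fin N) ℝ} (hA : PosMat A) {u : Fin N → ℝ}
    {c : ℝ} (h : c • u ≤ A.mulVec u) (hne : A.mulVec u ≠ c • u) (i : Fin N) :
    c * A.mulVec u i < A.mulVec (A.mulVec u) i := by
  have := hA.posVec_mulVec (sub_nonneg.2 h) (sub_ne_zero.2 hne) i
  rw [Matrix.mulVec_sub, Matrix.mulVec_smul] at this
  simpa using this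

theorem PosMat.mulVec_lt_smul {A : Matrix (Fin N) (Fin N) ℝ} (hA : PosMat A) {u : Fin N → ℝ}
    {c : ℝ} (h : A.mulVec u ≤ c • u) (hne : A.mulVec u ≠ c • u) (i : Fin N) :
    A.mulVec (A.mulVec u) i < c * A.mulVec u i := by
  have := hA.posVec_mulVec (sub_nonneg.2 h) (sub_ne_zero.2 hne.symm) i
  rw [Matrix.mulVec_sub, Matrix.mulVec_smul] at this
  simpa using this

theorem exists_gt_smul_le [NeZero N] {w z : Fin N → ℝ} (hw : PosVec w) {c : ℝ}
    (h : ∀ i, c * w i < z i) : ∃ c' > c, c' • w ≤ z := by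
  obtain ⟨k, hk⟩ := Finite.exists_min fun i => z i / w i
  refine ⟨z k / w k, (lt_div_iff₀ (hw k)).2 (h k), fun i => ?_⟩
  exact (le_div_iff₀ (hw i)).1 (hk i)

theorem exists_lt_le_smul [NeZero N] {w z : Fin N → ℝ} (hw : PosVec w) {c : ℝ}
    (h : ∀ i, z i < c * w i) : ∃ c' < c, z ≤ c' • w := by
  obtain ⟨k, hk⟩ := Finite.exists_max fun i => z i / w i
  refine ⟨z k / w k, (div_lt_iff₀ (hw k)).2 (h k), fun i => ?_⟩
  exact (div_le_iff₀ (hw i)).1 (hk i)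

theorem PosVec.ne_zero [NeZero N] {u : Fin N → ℝ} (hu : PosVec u) : u ≠ 0 := fun h => by
  simpa [h] using hu 0

/-- Replacing `u` by `A u` leaves room in every coordinate for some `c' > c`, to which the
non-strict bound applies. -/
theorem PosMat.lt_rho [NeZero N] {A : Matrix (Fin N) (Fin N) ℝ} (hA : PosMat A) {u : Fin N → ℝ}
    (hu : PosVec u) {c : ℝ} (h : c • u ≤ A.mulVec u) (hne : A.mulVec u ≠ c • u) : c < rho A := by
  have hw : PosVec (A.mulVec u) := hA.posVec_mulVec (fun i => (hu i).le) hu.ne_zero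
  obtain ⟨c', hc, hle⟩ := exists_gt_smul_le hw (hA.smul_mulVec_lt h hne)
  exact hc.trans_le (le_rho_of_smul_le_mulVec hA.nonnegMat hw hle)

theorem PosMat.rho_lt [NeZero N] {A : Matrix (Fin N) (Fin N) ℝ} (hA : PosMat A) {u : Fin N → ℝ}
    (hu : PosVec u) {c : ℝ} (h : A.mulVec u ≤ c • u) (hne : A.mulVec u ≠ c • u) : rho A < c := by
  have hw : PosVec (A.mulVec u) := hA.posVec_mulVec (fun i => (hu i).le) hu.ne_zero
  obtain ⟨c', hc, hle⟩ := exists_lt_le_smul hw (hA.mulVec_lt_smul h hne)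
  exact (rho_le_of_mulVec_le_smul hA.nonnegMat hw hle).trans_lt hc

/-- **Perron's theorem**: a positive matrix has a positive eigenvector for its spectral radius. -/
theorem PosMat.exists_posVec_mulVec_eq [NeZero N] {A : Matrix (Fin N) (Fin N) ℝ}
    (hA : PosMat A) : ∃ u, PosVec u ∧ A.mulVec u = rho A • u := by
  set K : ℝ := ∑ i, ∑ j, A i j
  have hbound : ∀ (c : ℝ) (x : Fin N → ℝ), x ∈ stdSimplex ℝ (Fin N) → c • x ≤ A.mulVec x →
      c ≤ K := by
    intro c x hx h
    calc c = ∑ i, c * x i := by rw [← Finset.mul_sum, hx.2, mul_one]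
      _ ≤ ∑ i, A.mulVec x i := Finset.sum_le_sum fun i _ => h i
      _ ≤ K := Finset.sum_le_sum fun i _ => by
        rw [mulVec_apply_eq_sum]
        refine Finset.sum_le_sum fun j _ => mul_le_of_le_one_right (hA i j).le ?_
        rw [← hx.2]
        exact Finset.single_le_sum (fun k _ => hx.1 k) (Finset.mem_univ j)
  -- The Perron root is found by maximising `c` over the pairs with `c x ≤ A x`, `x` in the simplex;
  -- the bound `c ≤ K` makes this set of pairs compact.
  set T : Set (ℝ × (Fin N → ℝ)) :=
    (Set.Icc 0 K ×ˢ stdSimplex ℝ (Fin N)) ∩ {q | q.1 • q.2 ≤ A.mulVec q.2}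
  have hT : IsCompact T :=
    (isCompact_Icc.prod (isCompact_stdSimplex ℝ (Fin N))).inter_right
      (isClosed_le (continuous_fst.smul continuous_snd)
        (Continuous.matrix_mulVec continuous_const continuous_snd))
  have hK : 0 ≤ K := Finset.sum_nonneg fun i _ => Finset.sum_nonneg fun j _ => (hA i j).le
  have hne : T.Nonempty := by
    refine ⟨(0, Pi.single 0 1), ⟨⟨le_rfl, hK⟩, single_mem_stdSimplex ℝ 0⟩, ?_⟩
    change (0 : ℝ) • (Pi.single 0 1 : Fin N → ℝ) ≤ A.mulVec (Pi.single 0 1)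
    rw [zero_smul]
    intro i
    simpa using (hA i 0).le
  obtain ⟨⟨r, x⟩, ⟨⟨hr, hx⟩, hrx⟩, hmax⟩ := hT.exists_isMaxOn hne continuous_fst.continuousOn
  have hx0 : x ≠ 0 := fun h => by
    have := hx.2
    simp [h] at this
  have hw : PosVec (A.mulVec x) := hA.posVec_mulVec hx.1 hx0
  have heq : A.mulVec x = r • x := by
    by_contra hcon
    obtain ⟨c', hc, hle⟩ := exists_gt_smul_le hw (hA.smul_mulVec_lt hrx hcon)
    set w := A.mulVec x
    have hs : 0 < ∑ i, w i := Finset.sum_pos (fun i _ => hw i) ⟨0, Finset.mem_univ _⟩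
    have hmem : (∑ i, w i)⁻¹ • w ∈ stdSimplex ℝ (Fin N) := by
      refine ⟨fun i => mul_nonneg (inv_nonneg.2 hs.le) (hw i).le, ?_⟩
      simp only [Pi.smul_apply, smul_eq_mul]
      rw [← Finset.mul_sum, inv_mul_cancel₀ hs.ne']
    have hle' : c' • ((∑ i, w i)⁻¹ • w) ≤ A.mulVec ((∑ i, w i)⁻¹ • w) := by
      rw [Matrix.mulVec_smul, smul_comm]
      exact smul_le_smul_of_nonneg_left hle (inv_nonneg.2 hs.le)
    have : c' ≤ r := hmax (show (c', (∑ i, w i)⁻¹ • w) ∈ T from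
      ⟨⟨⟨hr.1.trans hc.le, hbound _ _ hmem hle'⟩, hmem⟩, hle'⟩)
    exact absurd hc this.not_gt
  have hxpos : PosVec x := fun i => by
    have h1 : 0 < r * x i := by
      have := hw i
      rwa [heq] at this
    exact pos_of_mul_pos_right h1 hr.1
  refine ⟨x, hxpos, ?_⟩
  rw [heq, le_antisymm (rho_le_of_mulVec_le_smul hA.nonnegMat hxpos heq.le)
    (le_rho_of_smul_le_mulVec hA.nonnegMat hxpos heq.ge)]

theorem nonnegMat_list_prod {l : List (Matrix (Fin N) (Fin N) ℝ)} (hl : ∀ A ∈ l, NonnegMat A) :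
    NonnegMat l.prod :=
  List.prod_induction NonnegMat (fun _ _ => NonnegMat.mul) nonnegMat_one hl

/-- All factors share the test vector `u`, so the bounds multiply whatever the order of the factors.
-/
theorem pow_smul_le_list_prod_mulVec {l : List (Matrix (Fin N) (Fin N) ℝ)} {u : Fin N → ℝ} {c : ℝ}
    (hc : 0 ≤ c) (hl : ∀ A ∈ l, NonnegMat A ∧ c • u ≤ A.mulVec u) :
    c ^ l.length • u ≤ l.prod.mulVec u := by
  induction l with
  | nil => simp
  | cons B l ih =>
    have hB := hl B List.mem_cons_self
    rw [List.prod_cons, List.length_cons, ← Matrix.mulVec_mulVec]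
    calc c ^ (l.length + 1) • u = c ^ l.length • c • u := by rw [smul_smul, pow_succ]
      _ ≤ c ^ l.length • B.mulVec u := smul_le_smul_of_nonneg_left hB.2 (by positivity)
      _ = B.mulVec (c ^ l.length • u) := by rw [Matrix.mulVec_smul]
      _ ≤ _ := hB.1.mulVec_mono (ih fun A hA => hl A (List.mem_cons_of_mem _ hA))

theorem list_prod_mulVec_le_pow_smul {l : List (Matrix (Fin N) (Fin N) ℝ)} {u : Fin N → ℝ} {c : ℝ}
    (hc : 0 ≤ c) (hl : ∀ A ∈ l, NonnegMat A ∧ A.mulVec u ≤ c • u) :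
    l.prod.mulVec u ≤ c ^ l.length • u := by
  induction l with
  | nil => simp
  | cons B l ih =>
    have hB := hl B List.mem_cons_self
    rw [List.prod_cons, List.length_cons, ← Matrix.mulVec_mulVec]
    calc B.mulVec (l.prod.mulVec u) ≤ B.mulVec (c ^ l.length • u) :=
          hB.1.mulVec_mono (ih fun A hA => hl A (List.mem_cons_of_mem _ hA))
      _ = c ^ l.length • B.mulVec u := by rw [Matrix.mulVec_smul]
      _ ≤ c ^ l.length • c • u := smul_le_smul_of_nonneg_left hB.2 (by positivity)
      _ = _ := by rw [smul_smul, pow_succ]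

theorem convex_setOf_nonnegMat_and_le_mulVec (u v : Fin N → ℝ) :
    Convex ℝ {A : Matrix (Fin N) (Fin N) ℝ | NonnegMat A ∧ v ≤ A.mulVec u} := by
  intro A hA B hB a b ha hb hab
  refine ⟨fun i j => add_nonneg (mul_nonneg ha (hA.1 i j)) (mul_nonneg hb (hB.1 i j)), ?_⟩
  rw [Matrix.add_mulVec, Matrix.smul_mulVec, Matrix.smul_mulVec]
  calc v = a • v + b • v := by rw [← add_smul, hab, one_smul]
    _ ≤ _ := add_le_add (smul_le_smul_of_nonneg_left hA.2 ha)
      (smul_le_smul_of_nonneg_left hB.2 hb)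

theorem convex_setOf_nonnegMat_and_mulVec_le (u v : Fin N → ℝ) :
    Convex ℝ {A : Matrix (Fin N) (Fin N) ℝ | NonnegMat A ∧ A.mulVec u ≤ v} := by
  intro A hA B hB a b ha hb hab
  refine ⟨fun i j => add_nonneg (mul_nonneg ha (hA.1 i j)) (mul_nonneg hb (hB.1 i j)), ?_⟩
  rw [Matrix.add_mulVec, Matrix.smul_mulVec, Matrix.smul_mulVec]
  calc a • A.mulVec u + b • B.mulVec u ≤ a • v + b • v :=
        add_le_add (smul_le_smul_of_nonneg_left hA.2 ha) (smul_le_smul_of_nonneg_left hB.2 hb)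
    _ = v := by rw [← add_smul, hab, one_smul]

/-- The core of the lower bound: H1 at the Perron vector of a minimiser rules out its second
alternative, and the first one is stable under convex hulls and products. -/
theorem IsHourglass.exists_forall_pow_le_rho_list_prod [NeZero N]
    {ℬ : Set (Matrix (Fin N) (Fin N) ℝ)} (h : IsHourglass ℬ) (hc : IsCompact ℬ)
    (hne : ℬ.Nonempty) :
    ∃ M ∈ ℬ, ∀ l : List (Matrix (Fin N) (Fin N) ℝ), (∀ A ∈ l, A ∈ convexHull ℝ ℬ) →
      rho M ^ l.length ≤ rho l.prod := by
  obtain ⟨M, hM, hmin⟩ := hc.exists_isMinOn hne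
    (continuousOn_rho.mono fun A hA => (h.1 A hA).nonnegMat)
  obtain ⟨u, hu, hMu⟩ := (h.1 M hM).exists_posVec_mulVec_eq
  -- The hourglass condition requires a positive `v`; here `v = M u` with `M` positive.
  have hv : PosVec (rho M • u) := hMu ▸
    (h.1 M hM).posVec_mulVec (fun i => (hu i).le) hu.ne_zero
  have hall : ∀ A ∈ ℬ, rho M • u ≤ A.mulVec u := by
    rcases (h.2 M hM u _ hu hv hMu).1 with h1 | ⟨A, hA, hle, hAne⟩
    · exact h1
    · exact absurd ((h.1 A hA).rho_lt hu hle hAne) (hmin hA).not_gt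
  have hco : convexHull ℝ ℬ ⊆ {A | NonnegMat A ∧ rho M • u ≤ A.mulVec u} :=
    convexHull_min (fun A hA => ⟨(h.1 A hA).nonnegMat, hall A hA⟩)
      (convex_setOf_nonnegMat_and_le_mulVec _ _)
  refine ⟨M, hM, fun l hl => le_rho_of_smul_le_mulVec
    (nonnegMat_list_prod fun A hA => (hco (hl A hA)).1) hu
    (pow_smul_le_list_prod_mulVec (rho_nonneg M) fun A hA => hco (hl A hA))⟩

theorem IsHourglass.exists_forall_rho_list_prod_le_pow [NeZero N]
    {ℬ : Set (Matrix (Fin N) (Fin N) ℝ)} (h : IsHourglass ℬ) (hc : IsCompact ℬ)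
    (hne : ℬ.Nonempty) :
    ∃ M ∈ ℬ, ∀ l : List (Matrix (Fin N) (Fin N) ℝ), (∀ A ∈ l, A ∈ convexHull ℝ ℬ) →
      rho l.prod ≤ rho M ^ l.length := by
  obtain ⟨M, hM, hmax⟩ := hc.exists_isMaxOn hne
    (continuousOn_rho.mono fun A hA => (h.1 A hA).nonnegMat)
  obtain ⟨u, hu, hMu⟩ := (h.1 M hM).exists_posVec_mulVec_eq
  have hv : PosVec (rho M • u) := hMu ▸
    (h.1 M hM).posVec_mulVec (fun i => (hu i).le) hu.ne_zero
  have hall : ∀ A ∈ ℬ, A.mulVec u ≤ rho M • u := by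
    rcases (h.2 M hM u _ hu hv hMu).2 with h1 | ⟨A, hA, hle, hAne⟩
    · exact h1
    · exact absurd ((h.1 A hA).lt_rho hu hle hAne) (hmax hA).not_gt
  have hco : convexHull ℝ ℬ ⊆ {A | NonnegMat A ∧ A.mulVec u ≤ rho M • u} :=
    convexHull_min (fun A hA => ⟨(h.1 A hA).nonnegMat, hall A hA⟩)
      (convex_setOf_nonnegMat_and_mulVec_le _ _)
  refine ⟨M, hM, fun l hl => rho_le_of_mulVec_le_smul
    (nonnegMat_list_prod fun A hA => (hco (hl A hA)).1) hu
    (list_prod_mulVec_le_pow_smul (rho_nonneg M) fun A hA => hco (hl A hA))⟩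

end Perron

/-! ### Passage to Hausdorff limits of hourglass sets. -/

section HausdorffLimit

attribute [local instance] Matrix.normedAddCommGroup Matrix.normedSpace

variable {N : ℕ}

/-- A set in the closure of the compact hourglass sets is the Hausdorff limit of a sequence of
them. -/
theorem exists_seq_of_mem_closureHourglass {𝒜 : Set (Matrix (Fin N) (Fin N) ℝ)}
    (h : 𝒜 ∈ closureHourglass N N) :
    ∃ ℬ : ℕ → Set (Matrix (Fin N) (Fin N) ℝ), (∀ k, ℬ k ∈ compactHourglass N N) ∧
      (∀ k, ∀ B ∈ ℬ k, ∃ A ∈ 𝒜, dist A B < 1 / ((k : ℝ) + 1)) ∧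
      ∀ k, ∀ A ∈ convexHull ℝ 𝒜, ∃ B ∈ convexHull ℝ (ℬ k), dist A B < 1 / ((k : ℝ) + 1) := by
  obtain ⟨hne, hc, happ⟩ := h
  choose ℬ hℬ hd using fun k : ℕ => happ (1 / ((k : ℝ) + 1)) Nat.one_div_pos_of_nat
  -- `Metric.hausdorffDist` takes the value `0` at infinite distance, so the approximation bound is
  -- usable only once finiteness is known.
  have hfin : ∀ k, Metric.hausdorffEDist 𝒜 (ℬ k) ≠ ⊤ := fun k =>
    Metric.hausdorffEDist_ne_top_of_nonempty_of_bounded hne (hℬ k).1 hc.isBounded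
      (hℬ k).2.1.isBounded
  refine ⟨ℬ, hℬ, fun k B hB => Metric.exists_dist_lt_of_hausdorffDist_lt' hB (hd k) (hfin k),
    fun k A hA => ?_⟩
  -- A thickening of a convex set is convex, so closeness of the sets passes to their convex hulls
  -- with the same radius.
  have hsub : 𝒜 ⊆ Metric.thickening (1 / ((k : ℝ) + 1)) (convexHull ℝ (ℬ k)) := fun A hA => by
    obtain ⟨B, hB, hAB⟩ := Metric.exists_dist_lt_of_hausdorffDist_lt hA (hd k) (hfin k)
    exact Metric.mem_thickening_iff.2 ⟨B, subset_convexHull ℝ _ hB, hAB⟩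
  exact Metric.mem_thickening_iff.1
    (convexHull_min hsub ((convex_convexHull ℝ _).thickening _) hA)

theorem tendsto_of_forall_dist_lt {f g : ℕ → Matrix (Fin N) (Fin N) ℝ}
    (h : ∀ k, dist (f k) (g k) < 1 / ((k : ℝ) + 1)) {φ : ℕ → ℕ} (hφ : StrictMono φ)
    {A : Matrix (Fin N) (Fin N) ℝ} (hf : Tendsto (f ∘ φ) atTop (𝓝 A)) :
    Tendsto (g ∘ φ) atTop (𝓝 A) := by
  have h0 : Tendsto (fun k => dist (f k) (g k)) atTop (𝓝 0) :=
    squeeze_zero (fun _ => dist_nonneg) (fun k => (h k).le) tendsto_one_div_add_atTop_nhds_zero_nat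
  exact (tendsto_iff_of_dist (h0.comp hφ.tendsto_atTop)).1 hf

theorem continuous_revProd {n : ℕ} :
    Continuous (revProd : (Fin n → Matrix (Fin N) (Fin N) ℝ) → Matrix (Fin N) (Fin N) ℝ) := by
  have h : (revProd : (Fin n → Matrix (Fin N) (Fin N) ℝ) → Matrix (Fin N) (Fin N) ℝ) =
      fun A => ((List.finRange n).reverse.map A).prod := by
    funext A
    rw [revProd, List.ofFn_eq_map, List.map_reverse]
  rw [h]
  exact continuous_list_prod _ fun i _ => continuous_apply i

/-- Limits of sequences of nonnegative matrices commute with `rho`. -/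
theorem tendsto_rho {f : ℕ → Matrix (Fin N) (Fin N) ℝ} (hf : ∀ k, NonnegMat (f k))
    {A : Matrix (Fin N) (Fin N) ℝ} (h : Tendsto f atTop (𝓝 A)) :
    Tendsto (fun k => rho (f k)) atTop (𝓝 (rho A)) := by
  have hA : NonnegMat A := fun i j =>
    ge_of_tendsto' ((continuous_id.matrix_elem i j).continuousAt.tendsto.comp h) fun k => hf k i j
  exact (continuousOn_rho A hA).tendsto.comp
    (tendsto_nhdsWithin_iff.2 ⟨h, Eventually.of_forall hf⟩)

theorem IsHourglass.nonnegMat_of_mem_convexHull {ℬ : Set (Matrix (Fin N) (Fin N) ℝ)}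
    (h : IsHourglass ℬ) {A : Matrix (Fin N) (Fin N) ℝ} (hA : A ∈ convexHull ℝ ℬ) :
    NonnegMat A := by
  -- With both vectors zero the inequality is trivial and only nonnegativity remains.
  have hsub : convexHull ℝ ℬ ⊆ {A | NonnegMat A ∧ 0 ≤ A.mulVec 0} :=
    convexHull_min (fun B hB => ⟨(h.1 B hB).nonnegMat, by simp⟩)
      (convex_setOf_nonnegMat_and_le_mulVec _ _)
  exact (hsub hA).1

/-- Passing to the Hausdorff limit: matrices chosen from the approximating hourglass sets
accumulate at a matrix of the limit set, and products of matrices from the convex hull are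
approximated along the same subsequence. -/
theorem exists_mem_tendsto_of_mem_closureHourglass {𝒜 : Set (Matrix (Fin N) (Fin N) ℝ)}
    (h : 𝒜 ∈ closureHourglass N N)
    (P : Matrix (Fin N) (Fin N) ℝ → Set (Matrix (Fin N) (Fin N) ℝ) → Prop)
    (hP : ∀ ℬ ∈ compactHourglass N N, ∃ M ∈ ℬ, P M (convexHull ℝ ℬ)) :
    ∃ M ∈ 𝒜, ∃ (m : ℕ → Matrix (Fin N) (Fin N) ℝ) (𝒞 : ℕ → Set (Matrix (Fin N) (Fin N) ℝ)),
      (∀ k, P (m k) (𝒞 k)) ∧ Tendsto (fun k => rho (m k)) atTop (𝓝 (rho M)) ∧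
      ∀ {n : ℕ} (A : Fin n → Matrix (Fin N) (Fin N) ℝ), (∀ i, A i ∈ convexHull ℝ 𝒜) →
        ∃ B : ℕ → Fin n → Matrix (Fin N) (Fin N) ℝ, (∀ k i, B k i ∈ 𝒞 k) ∧
          Tendsto (fun k => rho (revProd (B k))) atTop (𝓝 (rho (revProd A))) := by
  obtain ⟨ℬ, hℬ, hd₁, hd₂⟩ := exists_seq_of_mem_closureHourglass h
  choose m hm hPm using fun k => hP (ℬ k) (hℬ k)
  choose a ha had using fun k => hd₁ k (m k) (hm k)
  have : FirstCountableTopology (Matrix (Fin N) (Fin N) ℝ) :=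
    inferInstanceAs (FirstCountableTopology (Fin N → Fin N → ℝ))
  obtain ⟨M, hM, φ, hφ, hlim⟩ := h.2.1.tendsto_subseq ha
  refine ⟨M, hM, m ∘ φ, fun k => convexHull ℝ (ℬ (φ k)), fun k => hPm (φ k),
    tendsto_rho (fun k => ((hℬ (φ k)).2.2.1 _ (hm (φ k))).nonnegMat)
      (tendsto_of_forall_dist_lt had hφ hlim), fun {n} A hA => ?_⟩
  choose B hB hdB using fun k i => hd₂ k (A i) (hA i)
  refine ⟨B ∘ φ, fun k i => hB (φ k) i, tendsto_rho (fun k => ?_) ?_⟩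
  · refine nonnegMat_list_prod fun C hC => ?_
    obtain ⟨i, rfl⟩ := List.mem_ofFn.1 (List.mem_reverse.1 hC)
    exact (hℬ (φ k)).2.2.nonnegMat_of_mem_convexHull (hB (φ k) i)
  · refine (continuous_revProd.tendsto A).comp (tendsto_pi_nhds.2 fun i => ?_)
    exact tendsto_of_forall_dist_lt (f := fun _ => A i) (g := fun k => B k i)
      (fun k => hdB k i) hφ tendsto_const_nhds

theorem forall_mem_reverse_ofFn {n : ℕ} {A : Fin n → Matrix (Fin N) (Fin N) ℝ}
    {𝒞 : Set (Matrix (Fin N) (Fin N) ℝ)} (hA : ∀ i, A i ∈ 𝒞) :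
    ∀ B ∈ (List.ofFn A).reverse, B ∈ 𝒞 := fun B hB => by
  obtain ⟨i, rfl⟩ := List.mem_ofFn.1 (List.mem_reverse.1 hB)
  exact hA i

theorem exists_forall_pow_le_rho_revProd {𝒜 : Set (Matrix (Fin N) (Fin N) ℝ)}
    (h : 𝒜 ∈ closureHourglass N N) :
    ∃ M ∈ 𝒜, ∀ n : ℕ, n ≠ 0 → ∀ A : Fin n → Matrix (Fin N) (Fin N) ℝ,
      (∀ i, A i ∈ convexHull ℝ 𝒜) → rho M ^ n ≤ rho (revProd A) := by
  -- For `N = 0` every spectral radius is `0`, and `n ≠ 0` is what makes `0 ^ n = 0`.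
  rcases Nat.eq_zero_or_pos N with rfl | hN
  · obtain ⟨M, hM⟩ := h.1
    exact ⟨M, hM, fun n hn A _ => by simp [rho_eq_zero_of_isEmpty, hn]⟩
  have : NeZero N := ⟨hN.ne'⟩
  obtain ⟨M, hM, m, 𝒞, hP, hlim, happ⟩ := exists_mem_tendsto_of_mem_closureHourglass h
    (fun M 𝒞 => ∀ l : List (Matrix (Fin N) (Fin N) ℝ), (∀ A ∈ l, A ∈ 𝒞) →
      rho M ^ l.length ≤ rho l.prod)
    fun ℬ hℬ => hℬ.2.2.exists_forall_pow_le_rho_list_prod hℬ.2.1 hℬ.1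
  refine ⟨M, hM, fun n _ A hA => ?_⟩
  obtain ⟨B, hB, hBlim⟩ := happ A hA
  refine le_of_tendsto_of_tendsto' (hlim.pow n) hBlim fun k => ?_
  simpa [revProd] using hP k _ (forall_mem_reverse_ofFn (hB k))

theorem exists_forall_rho_revProd_le_pow {𝒜 : Set (Matrix (Fin N) (Fin N) ℝ)}
    (h : 𝒜 ∈ closureHourglass N N) :
    ∃ M ∈ 𝒜, ∀ n : ℕ, n ≠ 0 → ∀ A : Fin n → Matrix (Fin N) (Fin N) ℝ,
      (∀ i, A i ∈ convexHull ℝ 𝒜) → rho (revProd A) ≤ rho M ^ n := by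
  rcases Nat.eq_zero_or_pos N with rfl | hN
  · obtain ⟨M, hM⟩ := h.1
    exact ⟨M, hM, fun n hn A _ => by simp [rho_eq_zero_of_isEmpty, hn]⟩
  have : NeZero N := ⟨hN.ne'⟩
  obtain ⟨M, hM, m, 𝒞, hP, hlim, happ⟩ := exists_mem_tendsto_of_mem_closureHourglass h
    (fun M 𝒞 => ∀ l : List (Matrix (Fin N) (Fin N) ℝ), (∀ A ∈ l, A ∈ 𝒞) →
      rho l.prod ≤ rho M ^ l.length)
    fun ℬ hℬ => hℬ.2.2.exists_forall_rho_list_prod_le_pow hℬ.2.1 hℬ.1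
  refine ⟨M, hM, fun n _ A hA => ?_⟩
  obtain ⟨B, hB, hBlim⟩ := happ A hA
  refine le_of_tendsto_of_tendsto' hBlim (hlim.pow n) fun k => ?_
  simpa [revProd] using hP k _ (forall_mem_reverse_ofFn (hB k))

end HausdorffLimit

/-! ### The matrix norm generated by `p`: comparison with the row-sum norm and Gelfand's formula. -/

section InducedNorm

attribute [local instance] Matrix.linftyOpNormedRing Matrix.linftyOpNormedAlgebra

variable {N : ℕ} (p : Seminorm ℝ (Fin N → ℝ))

theorem seminorm_exists_le_mul_norm : ∃ b > 0, ∀ x, p x ≤ b * ‖x‖ := by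
  refine ⟨∑ i, p (Pi.single i 1) + 1, by positivity, fun x => ?_⟩
  calc p x = p (∑ i, x i • Pi.single i (1 : ℝ)) := by rw [← pi_eq_sum_univ' x]
    _ ≤ ∑ i, p (x i • Pi.single i (1 : ℝ)) :=
        Finset.le_sum_of_subadditive p (map_zero p).le (map_add_le_add p) _ _
    _ = ∑ i, ‖x i‖ * p (Pi.single i 1) := by simp_rw [map_smul_eq_mul]
    _ ≤ ∑ i, ‖x‖ * p (Pi.single i 1) := by
        gcongr with i
        exact norm_le_pi_norm x i
    _ ≤ _ := by
        rw [← Finset.mul_sum, mul_comm]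
        gcongr
        linarith

theorem seminorm_exists_mul_norm_le (hp : ∀ x, p x = 0 → x = 0) :
    ∃ a > 0, ∀ x, a * ‖x‖ ≤ p x := by
  obtain ⟨b, hb, hle⟩ := seminorm_exists_le_mul_norm p
  have hcont : Continuous p := by
    refine (LipschitzWith.of_dist_le_mul (K := ⟨b, hb.le⟩) fun x y => ?_).continuous
    rw [Real.dist_eq, dist_eq_norm]
    exact (abs_sub_map_le_sub p x y).trans (hle _)
  -- The constant is the minimum of `p` on the unit sphere, which is empty exactly when `N = 0`.
  rcases (Metric.sphere (0 : Fin N → ℝ) 1).eq_empty_or_nonempty with h | h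
  · refine ⟨1, one_pos, fun x => ?_⟩
    rcases eq_or_ne x 0 with rfl | hx
    · simp
    · have : ‖x‖⁻¹ • x ∈ Metric.sphere (0 : Fin N → ℝ) 1 := by
        rw [mem_sphere_zero_iff_norm, norm_smul, norm_inv, norm_norm,
          inv_mul_cancel₀ (norm_ne_zero_iff.2 hx)]
      rw [h] at this
      exact this.elim
  · obtain ⟨y, hy, hmin⟩ := (isCompact_sphere (0 : Fin N → ℝ) 1).exists_isMinOn h
      hcont.continuousOn
    have hy0 : y ≠ 0 := fun h0 => by simp [h0] at hy
    refine ⟨p y, (apply_nonneg p y).lt_of_ne' fun h0 => hy0 (hp y h0), fun x => ?_⟩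
    rcases eq_or_ne x 0 with rfl | hx
    · simp
    · have hx' : 0 < ‖x‖ := norm_pos_iff.2 hx
      have : ‖x‖⁻¹ • x ∈ Metric.sphere (0 : Fin N → ℝ) 1 := by
        rw [mem_sphere_zero_iff_norm, norm_smul, norm_inv, norm_norm, inv_mul_cancel₀ hx'.ne']
      have h1 : p y ≤ p (‖x‖⁻¹ • x) := hmin this
      rw [map_smul_eq_mul, norm_inv, norm_norm, inv_mul_eq_div, le_div_iff₀ hx'] at h1
      exact h1

variable {p}

theorem inducedNorm_nonneg (A : Matrix (Fin N) (Fin N) ℝ) : 0 ≤ inducedNorm p A :=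
  Real.sSup_nonneg (by rintro _ ⟨x, -, rfl⟩; exact apply_nonneg p _)

theorem exists_forall_mulVec_le_mul_norm (hp : ∀ x, p x = 0 → x = 0) :
    ∃ K > 0, ∀ (A : Matrix (Fin N) (Fin N) ℝ) (x : Fin N → ℝ), p x ≤ 1 →
      p (A.mulVec x) ≤ K * ‖A‖ := by
  obtain ⟨b, hb, hle⟩ := seminorm_exists_le_mul_norm p
  obtain ⟨a, ha, hge⟩ := seminorm_exists_mul_norm_le p hp
  refine ⟨b / a, div_pos hb ha, fun A x hx => ?_⟩
  have hxa : ‖x‖ ≤ 1 / a := by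
    rw [le_div_iff₀ ha, mul_comm]
    exact (hge x).trans hx
  calc p (A.mulVec x) ≤ b * ‖A.mulVec x‖ := hle _
    _ ≤ b * (‖A‖ * (1 / a)) := by
        gcongr
        exact (Matrix.linfty_opNorm_mulVec A x).trans (by gcongr)
    _ = _ := by ring

theorem apply_mulVec_le_inducedNorm_mul (hp : ∀ x, p x = 0 → x = 0)
    (A : Matrix (Fin N) (Fin N) ℝ) (x : Fin N → ℝ) :
    p (A.mulVec x) ≤ inducedNorm p A * p x := by
  rcases (apply_nonneg p x).eq_or_lt with h | h
  · simp [hp x h.symm]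
  · obtain ⟨K, -, hK⟩ := exists_forall_mulVec_le_mul_norm hp
    have hbdd : BddAbove {r | ∃ x : Fin N → ℝ, p x ≤ 1 ∧ r = p (A.mulVec x)} :=
      ⟨K * ‖A‖, by rintro _ ⟨x, hx, rfl⟩; exact hK A x hx⟩
    have h1 : p (A.mulVec ((p x)⁻¹ • x)) ≤ inducedNorm p A := by
      refine le_csSup hbdd ⟨_, ?_, rfl⟩
      rw [map_smul_eq_mul, norm_inv, Real.norm_of_nonneg h.le, inv_mul_cancel₀ h.ne']
    rwa [Matrix.mulVec_smul, map_smul_eq_mul, norm_inv, Real.norm_of_nonneg h.le, inv_mul_eq_div,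
      div_le_iff₀ h] at h1

theorem inducedNorm_le_of_forall {A : Matrix (Fin N) (Fin N) ℝ} {c : ℝ} (hc : 0 ≤ c)
    (h : ∀ x, p (A.mulVec x) ≤ c * p x) : inducedNorm p A ≤ c := by
  refine csSup_le ⟨_, 0, by simp, rfl⟩ ?_
  rintro _ ⟨x, hx, rfl⟩
  exact (h x).trans (mul_le_of_le_one_right hc hx)

theorem inducedNorm_pow_le (hp : ∀ x, p x = 0 → x = 0) (A : Matrix (Fin N) (Fin N) ℝ) (n : ℕ) :
    inducedNorm p (A ^ n) ≤ inducedNorm p A ^ n := by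
  refine inducedNorm_le_of_forall (pow_nonneg (inducedNorm_nonneg A) n) fun x => ?_
  induction n with
  | zero => simp
  | succ n ih =>
    rw [pow_succ', ← Matrix.mulVec_mulVec, pow_succ', mul_assoc]
    exact (apply_mulVec_le_inducedNorm_mul hp _ _).trans
      (mul_le_mul_of_nonneg_left ih (inducedNorm_nonneg A))

theorem tendsto_inducedNorm_pow_rpow (hp : ∀ x, p x = 0 → x = 0)
    (A : Matrix (Fin N) (Fin N) ℝ) :
    Tendsto (fun n : ℕ => inducedNorm p (A ^ n) ^ (1 / n : ℝ)) atTop (𝓝 (rho A)) := by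
  obtain ⟨K, hK0, hK⟩ := exists_forall_mulVec_le_mul_norm hp
  obtain ⟨b, hb, hle⟩ := seminorm_exists_le_mul_norm p
  obtain ⟨a, ha, hge⟩ := seminorm_exists_mul_norm_le p hp
  refine tendsto_pow_rpow_of_equiv (div_pos ha hb) hK0 (fun A => ?_) (fun A => ?_) A
  -- The row-sum norm is the operator norm of the maximum norm, so it is bounded by testing on
  -- vectors and comparing `p` with the maximum norm on both sides.
  · rw [div_mul_eq_mul_div, div_le_iff₀ hb, mul_comm, ← le_div_iff₀ ha,
      Matrix.linfty_opNorm_eq_opNorm]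
    refine ContinuousLinearMap.opNorm_le_bound _
      (div_nonneg (mul_nonneg (inducedNorm_nonneg A) hb.le) ha.le) fun x => ?_
    change ‖A.mulVec x‖ ≤ _
    rw [div_mul_eq_mul_div, le_div_iff₀ ha, mul_comm]
    calc a * ‖A.mulVec x‖ ≤ p (A.mulVec x) := hge _
      _ ≤ inducedNorm p A * p x := apply_mulVec_le_inducedNorm_mul hp A x
      _ ≤ inducedNorm p A * (b * ‖x‖) :=
          mul_le_mul_of_nonneg_left (hle x) (inducedNorm_nonneg A)
      _ = _ := by ring
  · refine csSup_le ⟨_, 0, by simp, rfl⟩ ?_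
    rintro _ ⟨x, hx, rfl⟩
    exact hK A x hx

theorem rho_le_inducedNorm (hp : ∀ x, p x = 0 → x = 0) (A : Matrix (Fin N) (Fin N) ℝ) :
    rho A ≤ inducedNorm p A :=
  rho_le_of_forall_le (tendsto_inducedNorm_pow_rpow hp A) inducedNorm_nonneg one_pos
    (inducedNorm_nonneg A) fun n _ => by simpa using inducedNorm_pow_le hp A n

end InducedNorm

/-! ### Extremal values of `f (Aₙ ⋯ A₁) ^ (1/n)` and their limits. -/

section RootValues

variable {N : ℕ}

theorem revProd_const (n : ℕ) (M : Matrix (Fin N) (Fin N) ℝ) :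
    revProd (fun _ : Fin n => M) = M ^ n := by
  simp [revProd]

theorem rpow_mem_rootValues (f : Matrix (Fin N) (Fin N) ℝ → ℝ) (n : ℕ)
    {𝒜 : Set (Matrix (Fin N) (Fin N) ℝ)} {M : Matrix (Fin N) (Fin N) ℝ} (hM : M ∈ 𝒜) :
    f (M ^ n) ^ (1 / (n : ℝ)) ∈ rootValues f n 𝒜 :=
  ⟨fun _ => M, fun _ => hM, by rw [revProd_const]⟩

theorem rho_mem_rootValues {n : ℕ} (hn : n ≠ 0) {𝒜 : Set (Matrix (Fin N) (Fin N) ℝ)}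
    {M : Matrix (Fin N) (Fin N) ℝ} (hM : M ∈ 𝒜) : rho M ∈ rootValues rho n 𝒜 := by
  have h := rpow_mem_rootValues rho n hM
  rwa [rho_pow M hn, one_div, Real.pow_rpow_inv_natCast (rho_nonneg M) hn] at h

theorem revProd_fin_one (A : Matrix (Fin N) (Fin N) ℝ) : revProd (fun _ : Fin 1 => A) = A := by
  rw [revProd_const, pow_one]

variable {𝒜 : Set (Matrix (Fin N) (Fin N) ℝ)} {M : Matrix (Fin N) (Fin N) ℝ}

theorem isLeast_image_rho (hM : M ∈ 𝒜)
    (h : ∀ n : ℕ, n ≠ 0 → ∀ A : Fin n → Matrix (Fin N) (Fin N) ℝ, (∀ i, A i ∈ 𝒜) →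
      rho M ^ n ≤ rho (revProd A)) : IsLeast (rho '' 𝒜) (rho M) := by
  refine ⟨⟨M, hM, rfl⟩, ?_⟩
  rintro _ ⟨A, hA, rfl⟩
  simpa [revProd_fin_one] using h 1 one_ne_zero (fun _ => A) fun _ => hA

theorem isGreatest_image_rho (hM : M ∈ 𝒜)
    (h : ∀ n : ℕ, n ≠ 0 → ∀ A : Fin n → Matrix (Fin N) (Fin N) ℝ, (∀ i, A i ∈ 𝒜) →
      rho (revProd A) ≤ rho M ^ n) : IsGreatest (rho '' 𝒜) (rho M) := by
  refine ⟨⟨M, hM, rfl⟩, ?_⟩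
  rintro _ ⟨A, hA, rfl⟩
  simpa [revProd_fin_one] using h 1 one_ne_zero (fun _ => A) fun _ => hA

/-- The general `f` serves both `rho` itself and the induced norm. -/
theorem le_of_mem_rootValues {f : Matrix (Fin N) (Fin N) ℝ → ℝ} (hf : ∀ B, rho B ≤ f B)
    (h : ∀ n : ℕ, n ≠ 0 → ∀ A : Fin n → Matrix (Fin N) (Fin N) ℝ, (∀ i, A i ∈ 𝒜) →
      rho M ^ n ≤ rho (revProd A)) {n : ℕ} (hn : n ≠ 0) {r : ℝ} (hr : r ∈ rootValues f n 𝒜) :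
    rho M ≤ r := by
  obtain ⟨A, hA, rfl⟩ := hr
  rw [← Real.pow_rpow_inv_natCast (rho_nonneg M) hn, ← one_div]
  exact Real.rpow_le_rpow (pow_nonneg (rho_nonneg M) n) ((h n hn A hA).trans (hf _))
    (by positivity)

theorem isLeast_rootValues_rho (hM : M ∈ 𝒜)
    (h : ∀ n : ℕ, n ≠ 0 → ∀ A : Fin n → Matrix (Fin N) (Fin N) ℝ, (∀ i, A i ∈ 𝒜) →
      rho M ^ n ≤ rho (revProd A)) {n : ℕ} (hn : n ≠ 0) :
    IsLeast (rootValues rho n 𝒜) (rho M) :=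
  ⟨rho_mem_rootValues hn hM, fun _ hr => le_of_mem_rootValues (fun _ => le_rfl) h hn hr⟩

theorem isGreatest_rootValues_rho (hM : M ∈ 𝒜)
    (h : ∀ n : ℕ, n ≠ 0 → ∀ A : Fin n → Matrix (Fin N) (Fin N) ℝ, (∀ i, A i ∈ 𝒜) →
      rho (revProd A) ≤ rho M ^ n) {n : ℕ} (hn : n ≠ 0) :
    IsGreatest (rootValues rho n 𝒜) (rho M) := by
  refine ⟨rho_mem_rootValues hn hM, ?_⟩
  rintro _ ⟨A, hA, rfl⟩
  rw [← Real.pow_rpow_inv_natCast (rho_nonneg M) hn, ← one_div]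
  exact Real.rpow_le_rpow (rho_nonneg _) (h n hn A hA) (by positivity)

variable {p : Seminorm ℝ (Fin N → ℝ)}

theorem rho_le_normCheck (hp : ∀ x, p x = 0 → x = 0) (hM : M ∈ 𝒜)
    (h : ∀ n : ℕ, n ≠ 0 → ∀ A : Fin n → Matrix (Fin N) (Fin N) ℝ, (∀ i, A i ∈ 𝒜) →
      rho M ^ n ≤ rho (revProd A)) {n : ℕ} (hn : n ≠ 0) : rho M ≤ normCheck p n 𝒜 :=
  le_csInf ⟨_, rpow_mem_rootValues _ n hM⟩ fun _ hr =>
    le_of_mem_rootValues (rho_le_inducedNorm hp) h hn hr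

/-- The infimum is squeezed between `ρ(M)` and the value at the constant sequence `M`, which tends
to `ρ(M)` by Gelfand's formula. -/
theorem tendsto_normCheck (hp : ∀ x, p x = 0 → x = 0) (hM : M ∈ 𝒜)
    (h : ∀ n : ℕ, n ≠ 0 → ∀ A : Fin n → Matrix (Fin N) (Fin N) ℝ, (∀ i, A i ∈ 𝒜) →
      rho M ^ n ≤ rho (revProd A)) :
    Tendsto (fun n : ℕ => normCheck p n 𝒜) atTop (𝓝 (rho M)) := by
  refine tendsto_of_tendsto_of_tendsto_of_le_of_le' tendsto_const_nhds
    (tendsto_inducedNorm_pow_rpow hp M) ?_ ?_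
  · filter_upwards [eventually_ne_atTop 0] with n hn using rho_le_normCheck hp hM h hn
  · filter_upwards [eventually_ne_atTop 0] with n hn
    exact csInf_le ⟨rho M, fun _ hr => le_of_mem_rootValues (rho_le_inducedNorm hp) h hn hr⟩
      (rpow_mem_rootValues _ n hM)

theorem lowerSpectralRadius_eq_rho (hp : ∀ x, p x = 0 → x = 0) (hM : M ∈ 𝒜)
    (h : ∀ n : ℕ, n ≠ 0 → ∀ A : Fin n → Matrix (Fin N) (Fin N) ℝ, (∀ i, A i ∈ 𝒜) →
      rho M ^ n ≤ rho (revProd A)) : lowerSpectralRadius p 𝒜 = rho M := by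
  have hbound : ∀ n : ℕ, rho M ≤ normCheck p (n + 1) 𝒜 := fun n =>
    rho_le_normCheck hp hM h n.succ_ne_zero
  refine le_antisymm ?_ (le_ciInf hbound)
  -- The infimum over `n` lies below every term, hence below their limit `ρ(M)`.
  exact ge_of_tendsto' ((tendsto_normCheck hp hM h).comp (tendsto_add_atTop_nat 1)) fun n =>
    ciInf_le ⟨rho M, by rintro _ ⟨n, rfl⟩; exact hbound n⟩ n

end RootValues

/--`p` is an arbitrary norm on `ℝᴺ`; it enters only through the definition of the lower spectral
radius. -/
theorem theorem2 (N : ℕ) (p : Seminorm ℝ (Fin N → ℝ)) (hp : ∀ x, p x = 0 → x = 0)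
    (𝒜 : Set (Matrix (Fin N) (Fin N) ℝ))
    (h𝒜 : 𝒜 ∈ closureHourglass N N)
    (𝒜' : Set (Matrix (Fin N) (Fin N) ℝ))
    (h₁ : 𝒜 ⊆ 𝒜')
    (h₂ : 𝒜' ⊆ convexHull ℝ 𝒜) :
    -- the minima and maxima of the spectral radii over both sets are attained
    (IsLeast (rho '' 𝒜) (rhoMin 𝒜) ∧
      IsLeast (rho '' 𝒜') (rhoMin 𝒜') ∧
      IsGreatest (rho '' 𝒜) (rhoMax 𝒜) ∧
      IsGreatest (rho '' 𝒜') (rhoMax 𝒜')) ∧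
    -- (i)
    ((∀ n : ℕ, 1 ≤ n → rhoCheck n 𝒜' = rhoMin 𝒜) ∧
      lowerSpectralRadius p 𝒜' = rhoMin 𝒜' ∧
      rhoMin 𝒜' = rhoMin 𝒜 ∧
      Tendsto (fun n : ℕ => normCheck p n 𝒜') atTop (𝓝 (lowerSpectralRadius p 𝒜')) ∧
      lowerSpectralRadius p 𝒜' = rhoCheck 1 𝒜') ∧
    -- (ii)
    ((∀ n : ℕ, 1 ≤ n → BddAbove (rootValues rho n 𝒜') ∧
        rhoHat n 𝒜' = rhoMax 𝒜) ∧
      generalizedSpectralRadius 𝒜' = rhoMax 𝒜' ∧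
      rhoMax 𝒜' = rhoMax 𝒜 ∧
      Tendsto (fun n : ℕ => rhoHat n 𝒜') atTop (𝓝 (generalizedSpectralRadius 𝒜')) ∧
      generalizedSpectralRadius 𝒜' = rhoHat 1 𝒜') := by
  obtain ⟨L, hL, hmin⟩ := exists_forall_pow_le_rho_revProd h𝒜
  obtain ⟨G, hG, hmax⟩ := exists_forall_rho_revProd_le_pow h𝒜
  have h𝒜co := subset_convexHull ℝ 𝒜
  have hmin' : ∀ n : ℕ, n ≠ 0 → ∀ A : Fin n → Matrix (Fin N) (Fin N) ℝ, (∀ i, A i ∈ 𝒜') →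
      rho L ^ n ≤ rho (revProd A) := fun n hn A hA => hmin n hn A fun i => h₂ (hA i)
  have hmax' : ∀ n : ℕ, n ≠ 0 → ∀ A : Fin n → Matrix (Fin N) (Fin N) ℝ, (∀ i, A i ∈ 𝒜') →
      rho (revProd A) ≤ rho G ^ n := fun n hn A hA => hmax n hn A fun i => h₂ (hA i)
  have hl := isLeast_image_rho hL fun n hn A hA => hmin n hn A fun i => h𝒜co (hA i)
  have hl' := isLeast_image_rho (h₁ hL) hmin'
  have hg := isGreatest_image_rho hG fun n hn A hA => hmax n hn A fun i => h𝒜co (hA i)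
  have hg' := isGreatest_image_rho (h₁ hG) hmax'
  have el : rhoMin 𝒜 = rho L := hl.csInf_eq
  have el' : rhoMin 𝒜' = rho L := hl'.csInf_eq
  have eg : rhoMax 𝒜 = rho G := hg.csSup_eq
  have eg' : rhoMax 𝒜' = rho G := hg'.csSup_eq
  have hcheck : ∀ n : ℕ, 1 ≤ n → rhoCheck n 𝒜' = rho L := fun n hn =>
    (isLeast_rootValues_rho (h₁ hL) hmin' (by omega)).csInf_eq
  have hgreat : ∀ n : ℕ, 1 ≤ n → IsGreatest (rootValues rho n 𝒜') (rho G) := fun n hn =>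
    isGreatest_rootValues_rho (h₁ hG) hmax' (by omega)
  have hhat : ∀ n : ℕ, 1 ≤ n → rhoHat n 𝒜' = rho G := fun n hn => (hgreat n hn).csSup_eq
  have hlow := lowerSpectralRadius_eq_rho hp (h₁ hL) hmin'
  have hgen : generalizedSpectralRadius 𝒜' = rho G := by
    -- The index starts at `1`, so the supremum is over a constant family.
    simp [generalizedSpectralRadius, hhat]
  rw [el, el', eg, eg', hlow, hgen]
  refine ⟨⟨hl, hl', hg, hg'⟩, ⟨hcheck, rfl, rfl, tendsto_normCheck hp (h₁ hL) hmin',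
    (hcheck 1 le_rfl).symm⟩, fun n hn => ⟨(hgreat n hn).bddAbove, hhat n hn⟩, rfl, rfl, ?_,
    (hhat 1 le_rfl).symm⟩
  -- Equality holds only eventually: at `n = 0` the exponent `1 / 0` is `0` and the value is `1`.
  refine tendsto_const_nhds.congr' ?_
  filter_upwards [eventually_ge_atTop 1] with n hn using (hhat n hn).symm
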